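/- **Definitions.** Let $B$ be a Boolean algebra with operations $+,\cdot,{}^*$. A *precontact* relation on $B$ is a binary relation $C$ such that (C1) $aCb$ implies $a\neq 0$ and $b\neq 0$; (C2) $aCb$, $a\le a'$, $b\le b'$ imply $a'Cb'$; (C3) $aC(b+c)$ implies $aCb$ or $aCc$, and $(a+b)Cc$ implies $aCc$ or $bCc$. It is a *contact* relation if moreover it is symmetric and $a\cdot b\neq 0$ implies $aCb$. A *clan* of $C$ is a set $\Gamma\subseteq B$ with $1\in\Gamma$, $0\notin\Gamma$, which is upward closed, contains $a$ or $b$ whenever it contains $a+b$, and satisfies $aCb$ for all $a,b\in\Gamma$. A *cluster* of $C$ is a clan $\Gamma$ such that for every $a\notin\Gamma$ there is $b\in\Gamma$ with not $aCb$. A *dynamic contact algebra* (DCA) is $A=(B_A,C^s_A,C^t_A,\mathcal B_A)$, where $B_A$ is a Boolean algebra with $0\ne1$, $C^s_A$ and $C^t_A$ are contact relations and $\mathcal B_A$ is a precontact relation on $B_A$, such that $C^s_A\subseteq C^t_A$ and: if not $aC^t_Ab$, there is $c$ with not $aC^t_Ac$ and not $c^*C^t_Ab$; if not $a\mathcal B_Ab$,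 there is $c$ with not $aC^t_Ac$ and not $c^*\mathcal B_Ab$; if not $a\mathcal B_Ab$, there is $c$ with not $a\mathcal B_Ac$ and not $c^*C^t_Ab$. Clans of $C^s_A$ are called s-clans, clans of $C^t_A$ t-clans, and *clusters* of $A$ are clusters of $C^t_A$. The category $\mathbf{DCA}$ has all DCAs as objects; its morphisms $f:A\to A'$ are the Boolean homomorphisms that reflect all three relations: $f(a)C^s_{A'}f(b)\Rightarrow aC^s_Ab$, and likewise for $C^t$ and $\mathcal B$. For a topological space $X$ let $RC(X)$ be the Boolean algebra of regular closed subsets of $X$ (join is union, $a^*=\mathrm{Cl}(X\setminus a)$, $a\cdot b=\mathrm{Cl}(\mathrm{Int}(a\cap b))$). A *dynamic mereotopological space* (DMS) is $S=(X^t_S,X^s_S,T_S,\prec_S,M_S)$, where $X^t_S$ is a nonempty topological space, $X^s_S,T_S\subseteq X^t_S$ are nonempty, $\prec_S$ is a binary relation on $X^t_S$, $M_S$ is a Boolean subalgebra of $RC(X^t_S)$ that is a base of closed sets for the topology, every nonempty $a\in RC(X^t_S)$ meets $X^s_S$, and, with $$aC^t_Sb\iff a\cap b\ne\varnothing,\qquad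 aC^s_Sb\iff a\cap b\cap X^s_S\neq\varnothing,\qquad a\mathcal B_Sb\iff \exists x\in a\,\exists y\in b\;\,x\prec_Sy,$$ the following hold: $S^+:=(M_S,C^s_S,C^t_S,\mathcal B_S)$ is a DCA; $x\prec_Sy$ if and only if $a\mathcal B_Sb$ for all $a,b\in M_S$ with $x\in a$ and $y\in b$; and for every $x\in T_S$ the set $\rho_S(x):=\{a\in M_S: x\in a\}$ is a cluster of $S^+$. A DMS $S$ is *T0* if $X^t_S$ is a T0 space, and *DM-compact* if every t-clan, every s-clan and every cluster of $S^+$ is of the form $\rho_S(x)$ with $x\in X^t_S$, $x\in X^s_S$ and $x\in T_S$, respectively. A DMS-morphism $\theta:S\to S'$ is a map $\theta:X^t_S\to X^t_{S'}$ which maps $X^s_S$ into $X^s_{S'}$, satisfies $x\prec_Sy\Rightarrow\theta(x)\prec_{S'}\theta(y)$, and is such that $a\mapsto\theta^{-1}(a)$ maps $M_{S'}$ into $M_S$ and is a Boolean homomorphism $M_{S'}\to M_S$. Let $\mathbf{DMS}^*$ be the category of all T0 and DM-compact DMSes with the DMS-morphisms. For a DCA $A$ let $A_+=(X^t_A,X^s_A,T_A,\prec_A,M_A)$,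 where $X^t_A$, $X^s_A$, $T_A$ are the sets of t-clans, s-clans and clusters of $A$; $\Gamma\prec_A\Delta$ iff $a\mathcal B_Ab$ for all $a\in\Gamma$, $b\in\Delta$; $g_A(a)=\{\Gamma\in X^t_A:a\in\Gamma\}$ for $a\in B_A$; $M_A=\{g_A(a):a\in B_A\}$; and $X^t_A$ carries the topology with closed base $M_A$. For a DCA-morphism $f:A\to A'$ let $f_+:(A')_+\to A_+$, $f_+(\Gamma)=f^{-1}(\Gamma)$; for a DMS-morphism $\theta:S\to S'$ let $\theta^+:(S')^+\to S^+$, $\theta^+(a)=\theta^{-1}(a)$. **Theorem** (Topological duality theorem for DCAs). The category $\mathbf{DCA}$ of all dynamic contact algebras is dually equivalent to the category $\mathbf{DMS}^*$ of all T0 and DM-compact dynamic mereotopological spaces. More precisely, $A\mapsto A_+$, $f\mapsto f_+$ is a contravariant functor $\mathbf{DCA}\to\mathbf{DMS}^*$, $S\mapsto S^+$, $\theta\mapsto\theta^+$ is a contravariant functor $\mathbf{DMS}^*\to\mathbf{DCA}$, and these functors form a dual (adjoint) equivalence whose natural isomorphisms are $g_A:A\to(A_+)^+$, $a\mapsto g_A(a)$,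 and $\rho_S:S\to(S^+)_+$, $x\mapsto\rho_S(x)$. -/

import Mathlib

open CategoryTheory Opposite

universe u

/-! ### Precontact and contact relations, clans and clusters -/

section Relations

variable {B : Type u} [BooleanAlgebra B]

/-- Precontact relations on a Boolean algebra. -/
structure IsPrecontact (C : B → B → Prop) : Prop where
  ne_bot : ∀ a b, C a b → a ≠ ⊥ ∧ b ≠ ⊥
  mono : ∀ a b a' b', C a b → a ≤ a' → b ≤ b' → C a' b'
  sup_right : ∀ a b c, C a (b ⊔ c) → C a b ∨ C a c
  sup_left : ∀ a b c, C (a ⊔ b) c → C a c ∨ C b c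

/-- Contact relations on a Boolean algebra. -/
structure IsContact (C : B → B → Prop) : Prop extends IsPrecontact C where
  symm : ∀ a b, C a b → C b a
  of_inf_ne_bot : ∀ a b, a ⊓ b ≠ ⊥ → C a b

/-- The axioms of dynamic contact algebras, for a space contact `Cs`, a time contact `Ct` and
a local precedence `P` on a Boolean algebra. -/
structure IsDCA (Cs Ct P : B → B → Prop) : Prop where
  bot_ne_top : (⊥ : B) ≠ ⊤
  space : IsContact Cs
  time : IsContact Ct
  time_of_space : ∀ a b, Cs a b → Ct a b
  time_efremovich : ∀ a b, ¬ Ct a b → ∃ c, ¬ Ct a c ∧ ¬ Ct cᶜ b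
  prec : IsPrecontact P
  time_prec : ∀ a b, ¬ P a b → ∃ c, ¬ Ct a c ∧ ¬ P cᶜ b
  prec_time : ∀ a b, ¬ P a b → ∃ c, ¬ P a c ∧ ¬ Ct cᶜ b

/-- Grills of a Boolean algebra. -/
structure IsGrill (Γ : Set B) : Prop where
  top_mem : ⊤ ∈ Γ
  bot_notMem : ⊥ ∉ Γ
  upward : ∀ a b, a ∈ Γ → a ≤ b → b ∈ Γ
  prime : ∀ a b, a ⊔ b ∈ Γ → a ∈ Γ ∨ b ∈ Γ

/-- Clans of a (contact) relation. -/
structure IsClan (C : B → B → Prop) (Γ : Set B) : Prop extends IsGrill Γ where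
  contact : ∀ a b, a ∈ Γ → b ∈ Γ → C a b

/-- Clusters of a (contact) relation. -/
structure IsCluster (C : B → B → Prop) (Γ : Set B) : Prop extends IsClan C Γ where
  cluster : ∀ a, a ∉ Γ → ∃ b ∈ Γ, ¬ C a b

/-! Helper facts: ultrafilters inside grills. -/

/-- A filter contained in a grill extends to an ultrafilter (a grill closed under meets)
contained in that grill. -/
theorem IsGrill.exists_ultra {G : Set B} (hG : IsGrill G) (F : Set B) (htop : ⊤ ∈ F)
    (hup : ∀ a b, a ∈ F → a ≤ b → b ∈ F) (hinf : ∀ a b, a ∈ F → b ∈ F → a ⊓ b ∈ F)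
    (hFG : F ⊆ G) :
    ∃ U : Set B, IsGrill U ∧ (∀ a b, a ∈ U → b ∈ U → a ⊓ b ∈ U) ∧ F ⊆ U ∧ U ⊆ G := by
  have hF : Order.IsPFilter F := by
    refine Order.IsPFilter.of_def ⟨⊤, htop⟩ ?_ ?_
    · intro a ha b hb
      exact ⟨a ⊓ b, hinf a b ha hb, inf_le_left, inf_le_right⟩
    · intro a b hab ha
      exact hup a b ha hab
  have hI : Order.IsIdeal Gᶜ := by
    refine ⟨?_, ⟨⊥, hG.bot_notMem⟩, ?_⟩
    · intro a b hab ha hb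
      exact ha (hG.upward _ _ hb hab)
    · intro a ha b hb
      refine ⟨a ⊔ b, ?_, le_sup_left, le_sup_right⟩
      intro h
      exact (hG.prime a b h).elim ha hb
  have hdis : Disjoint ((hF.toPFilter : Order.PFilter B) : Set B)
      ((hI.toIdeal : Order.Ideal B) : Set B) := by
    rw [Set.disjoint_left]
    intro a ha hb
    exact hb (hFG ha)
  obtain ⟨J, hJ, hIJ, hFJ⟩ := DistribLattice.prime_ideal_of_disjoint_filter_ideal hdis
  have hFJ' : ∀ a, a ∈ F → a ∉ J := fun a ha hb => Set.disjoint_left.1 hFJ ha hb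
  refine ⟨(J : Set B)ᶜ, ⟨hFJ' ⊤ htop, ?_, ?_, ?_⟩, ?_, hFJ', ?_⟩
  · exact fun h => h J.bot_mem
  · exact fun a b ha hab hb => ha (J.lower hab hb)
  · intro a b h
    by_contra hc
    have hc' : ¬ a ∉ J ∧ ¬ b ∉ J := not_or.1 hc
    exact h (J.sup_mem (not_not.1 hc'.1) (not_not.1 hc'.2))
  · intro a b ha hb h
    exact (hJ.mem_or_mem h).elim ha hb
  · intro a ha
    by_contra hc
    exact ha (hIJ hc)

/-- Every nonzero element lies in an ultrafilter contained in a given grill containing it. -/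
theorem IsGrill.exists_ultra_mem {G : Set B} (hG : IsGrill G) {a : B} (ha : a ∈ G) :
    ∃ U : Set B, IsGrill U ∧ (∀ a b, a ∈ U → b ∈ U → a ⊓ b ∈ U) ∧ a ∈ U ∧ U ⊆ G := by
  obtain ⟨U, h1, h2, h3, h4⟩ := hG.exists_ultra (Set.Ici a) (Set.mem_Ici.2 le_top)
    (fun b c hb hbc => le_trans hb hbc) (fun b c hb hc => le_inf hb hc)
    (fun b hb => hG.upward _ _ ha hb)
  exact ⟨U, h1, h2, h3 (Set.mem_Ici.2 le_rfl), h4⟩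

theorem isGrill_nonzero (h : (⊥ : B) ≠ ⊤) : IsGrill {a : B | a ≠ ⊥} where
  top_mem := h.symm
  bot_notMem := fun h => h rfl
  upward := fun a b ha hab hb => ha (le_bot_iff.1 (hb ▸ hab))
  prime := fun a b hab => by
    by_contra hc
    have hc' : ¬ a ≠ ⊥ ∧ ¬ b ≠ ⊥ := not_or.1 hc
    exact hab (by rw [not_not.1 hc'.1, not_not.1 hc'.2, sup_idem])

/-- An ultrafilter is a clan of every contact relation. -/
theorem IsContact.isClan_of_ultra {C : B → B → Prop} (hC : IsContact C) {U : Set B}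
    (hU : IsGrill U) (hinf : ∀ a b, a ∈ U → b ∈ U → a ⊓ b ∈ U) : IsClan C U where
  toIsGrill := hU
  contact := fun a b ha hb =>
    hC.of_inf_ne_bot a b fun h => hU.bot_notMem (h ▸ hinf a b ha hb)

/-- Elements in a precontact relation lie in ultrafilters related by it. -/
theorem IsPrecontact.exists_ultra {C : B → B → Prop} (hC : IsPrecontact C) {a b : B}
    (hab : C a b) :
    ∃ U V : Set B, IsGrill U ∧ (∀ a b, a ∈ U → b ∈ U → a ⊓ b ∈ U) ∧
      IsGrill V ∧ (∀ a b, a ∈ V → b ∈ V → a ⊓ b ∈ V) ∧ a ∈ U ∧ b ∈ V ∧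
      ∀ x y, x ∈ U → y ∈ V → C x y := by
  have h1 : IsGrill {x | C x b} :=
    { top_mem := hC.mono _ _ _ _ hab le_top le_rfl
      bot_notMem := fun h => (hC.ne_bot _ _ h).1 rfl
      upward := fun x y hx hxy => hC.mono _ _ _ _ hx hxy le_rfl
      prime := fun x y h => hC.sup_left _ _ _ h }
  obtain ⟨U, hU, hUi, haU, hUG⟩ := h1.exists_ultra_mem (a := a) hab
  have h2 : IsGrill {y | ∀ x ∈ U, C x y} :=
    { top_mem := fun x hx => hC.mono _ _ _ _ (hUG hx) le_rfl le_top
      bot_notMem := fun h => (hC.ne_bot _ _ (h ⊤ hU.top_mem)).2 rfl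
      upward := fun y z hy hyz x hx => hC.mono _ _ _ _ (hy x hx) le_rfl hyz
      prime := fun y z h => by
        by_contra hc
        obtain ⟨hy, hz⟩ := not_or.1 hc
        simp only [Set.mem_ofPred_eq, not_forall] at hy hz
        obtain ⟨x, hx, hxy⟩ := hy
        obtain ⟨x', hx', hxz⟩ := hz
        rcases hC.sup_right _ _ _ (h (x ⊓ x') (hUi _ _ hx hx')) with h' | h'
        · exact hxy (hC.mono _ _ _ _ h' inf_le_left le_rfl)
        · exact hxz (hC.mono _ _ _ _ h' inf_le_right le_rfl) }
  obtain ⟨V, hV, hVi, hbV, hVG⟩ := h2.exists_ultra_mem (a := b) (fun x hx => hUG hx)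
  exact ⟨U, V, hU, hUi, hV, hVi, haU, hbV, fun x y hx hy => hVG hy x hx⟩

/-- Elements in contact lie in a common clan. -/
theorem IsContact.exists_clan {C : B → B → Prop} (hC : IsContact C) {a b : B}
    (hab : C a b) : ∃ Γ, IsClan C Γ ∧ a ∈ Γ ∧ b ∈ Γ := by
  obtain ⟨U, V, hU, hUi, hV, hVi, haU, hbV, hUV⟩ := hC.toIsPrecontact.exists_ultra hab
  refine ⟨U ∪ V, ⟨⟨Or.inl hU.top_mem, ?_, ?_, ?_⟩, ?_⟩, Or.inl haU, Or.inr hbV⟩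
  · rintro (h | h)
    · exact hU.bot_notMem h
    · exact hV.bot_notMem h
  · rintro x y (h | h) hxy
    · exact Or.inl (hU.upward _ _ h hxy)
    · exact Or.inr (hV.upward _ _ h hxy)
  · rintro x y (h | h)
    · exact (hU.prime _ _ h).imp Or.inl Or.inl
    · exact (hV.prime _ _ h).imp Or.inr Or.inr
  · rintro x y (hx | hx) (hy | hy)
    · exact (hC.isClan_of_ultra hU hUi).contact _ _ hx hy
    · exact hUV _ _ hx hy
    · exact hC.symm _ _ (hUV _ _ hy hx)
    · exact (hC.isClan_of_ultra hV hVi).contact _ _ hx hy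

theorem IsDCA.exists_cluster {Cs Ct P : B → B → Prop} (h : IsDCA Cs Ct P) :
    ∃ Γ, IsCluster Ct Γ := by
  have hC := h.time
  obtain ⟨U, hU, hUi, -, -⟩ :=
    (isGrill_nonzero h.bot_ne_top).exists_ultra_mem (a := ⊤) h.bot_ne_top.symm
  have hUc := hC.isClan_of_ultra hU hUi
  refine ⟨{x | ∀ y ∈ U, Ct x y}, ⟨⟨⟨?_, ?_, ?_, ?_⟩, ?_⟩, ?_⟩⟩
  · exact fun y hy => hUc.contact _ _ hU.top_mem hy
  · exact fun h => (hC.ne_bot _ _ (h ⊤ hU.top_mem)).1 rfl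
  · exact fun x z hx hxz y hy => hC.mono _ _ _ _ (hx y hy) hxz le_rfl
  · intro x z hxz
    by_contra hc
    obtain ⟨hx, hz⟩ := not_or.1 hc
    simp only [Set.mem_ofPred_eq, not_forall] at hx hz
    obtain ⟨y, hy, hxy⟩ := hx
    obtain ⟨y', hy', hzy⟩ := hz
    rcases hC.sup_left _ _ _ (hxz (y ⊓ y') (hUi _ _ hy hy')) with h' | h'
    · exact hxy (hC.mono _ _ _ _ h' le_rfl inf_le_left)
    · exact hzy (hC.mono _ _ _ _ h' le_rfl inf_le_right)
  · intro x z hx hz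
    by_contra hc
    obtain ⟨c, h1, h2⟩ := h.time_efremovich _ _ hc
    have : c ⊔ cᶜ ∈ U := by rw [sup_compl_eq_top]; exact hU.top_mem
    rcases hU.prime _ _ this with h' | h'
    · exact h1 (hx _ h')
    · exact h2 (hC.symm _ _ (hz _ h'))
  · intro x hx
    simp only [Set.mem_ofPred_eq, not_forall] at hx
    obtain ⟨y, hy, hxy⟩ := hx
    exact ⟨y, fun z hz => hUc.contact _ _ hy hz, hxy⟩

/-- In a clan, the complement of `a` belongs to the clan iff every `b` with `a ⊔ b = ⊤` does. -/
theorem IsGrill.compl_mem_iff {Γ : Set B} (hΓ : IsGrill Γ) (a : B) :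
    aᶜ ∈ Γ ↔ ∀ b, a ⊔ b = ⊤ → b ∈ Γ :=
  ⟨fun h b hb => hΓ.upward _ _ h (by rwa [← codisjoint_iff, codisjoint_iff_compl_le_right] at hb),
    fun h => h _ sup_compl_eq_top⟩

/-- Clans pull back along homomorphisms that reflect the relation. -/
theorem IsClan.comap {B' : Type u} [BooleanAlgebra B'] {C : B → B → Prop}
    {C' : B' → B' → Prop} (f : BoundedLatticeHom B B') (hf : ∀ a b, C' (f a) (f b) → C a b)
    {Γ : Set B'} (hΓ : IsClan C' Γ) : IsClan C (f ⁻¹' Γ) where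
  top_mem := by simpa using hΓ.top_mem
  bot_notMem := by simpa using hΓ.bot_notMem
  upward := fun a b ha hab => hΓ.upward _ _ ha (OrderHomClass.mono f hab)
  prime := fun a b hab => hΓ.prime (f a) (f b) (by simpa using hab)
  contact := fun a b ha hb => hf _ _ (hΓ.contact _ _ ha hb)

end Relations

/-! ### The Boolean algebra of regular closed sets -/

/-- The regular closed subsets of a topological space. -/
@[ext]
structure RegularClosed (X : Type u) [TopologicalSpace X] where
  carrier : Set X
  closure_interior : closure (interior carrier) = carrier

namespace RegularClosed

variable {X : Type u} [TopologicalSpace X]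

instance : SetLike (RegularClosed X) X where
  coe := carrier
  coe_injective _ _ := RegularClosed.ext

@[simp] theorem coe_mk (s : Set X) (h) : ((⟨s, h⟩ : RegularClosed X) : Set X) = s := rfl

theorem closure_interior_coe (a : RegularClosed X) :
    closure (interior (a : Set X)) = a := a.closure_interior

theorem isClosed (a : RegularClosed X) : IsClosed (a : Set X) := by
  rw [← a.closure_interior_coe]; exact isClosed_closure

/-- The regular closed set `Cl (Int s)`. -/
def ofSet (s : Set X) : RegularClosed X where
  carrier := closure (interior s)
  closure_interior := by
    apply subset_antisymm
    · exact closure_minimal interior_subset isClosed_closure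
    · exact closure_mono (interior_maximal subset_closure isOpen_interior)

/-- Order is inclusion. -/
instance : PartialOrder (RegularClosed X) := .ofSetLike (RegularClosed X) X

/-- Join is union. -/
instance : Max (RegularClosed X) where
  max a b :=
    { carrier := (a : Set X) ∪ (b : Set X)
      closure_interior := by
        apply subset_antisymm
        · exact closure_minimal interior_subset (a.isClosed.union b.isClosed)
        · apply Set.union_subset
          · calc (a : Set X) = closure (interior a) := a.closure_interior_coe.symm
              _ ⊆ _ := closure_mono (interior_mono Set.subset_union_left)
          · calc (b : Set X) = closure (interior b) := b.closure_interior_coe.symm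
              _ ⊆ _ := closure_mono (interior_mono Set.subset_union_right) }

/-- Meet is `Cl (Int (a ∩ b))`. -/
instance : Min (RegularClosed X) where
  min a b := ofSet (a ∩ b)

instance : Top (RegularClosed X) where
  top := ⟨Set.univ, by simp⟩

instance : Bot (RegularClosed X) where
  bot := ⟨∅, by simp⟩

/-- The complement of `a` is `Cl (X ∖ a)`. -/
instance : Compl (RegularClosed X) where
  compl a :=
    { carrier := closure (a : Set X)ᶜ
      closure_interior := by
        apply subset_antisymm
        · exact closure_minimal interior_subset isClosed_closure
        · exact closure_mono (interior_maximal subset_closure a.isClosed.isOpen_compl) }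

@[simp] theorem coe_sup (a b : RegularClosed X) :
    ((a ⊔ b : RegularClosed X) : Set X) = (a : Set X) ∪ (b : Set X) := rfl
@[simp] theorem coe_inf (a b : RegularClosed X) :
    ((a ⊓ b : RegularClosed X) : Set X) = closure (interior (a ∩ b)) := rfl
@[simp] theorem coe_top : ((⊤ : RegularClosed X) : Set X) = Set.univ := rfl
@[simp] theorem coe_bot : ((⊥ : RegularClosed X) : Set X) = ∅ := rfl
@[simp] theorem coe_compl (a : RegularClosed X) :
    ((aᶜ : RegularClosed X) : Set X) = closure (a : Set X)ᶜ := rfl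

theorem coe_subset {a b : RegularClosed X} : (a : Set X) ⊆ b ↔ a ≤ b := Iff.rfl

theorem inf_subset (a b : RegularClosed X) : ((a ⊓ b : RegularClosed X) : Set X) ⊆ a ∩ b :=
  closure_minimal interior_subset (a.isClosed.inter b.isClosed)

/-- The Boolean algebra of regular closed sets. -/
instance : BooleanAlgebra (RegularClosed X) where
  sup := (· ⊔ ·)
  inf := (· ⊓ ·)
  le_sup_left a b := coe_subset.1 Set.subset_union_left
  le_sup_right a b := coe_subset.1 Set.subset_union_right
  sup_le a b c h1 h2 := coe_subset.1 (Set.union_subset (coe_subset.2 h1) (coe_subset.2 h2))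
  inf_le_left a b := coe_subset.1 ((inf_subset a b).trans Set.inter_subset_left)
  inf_le_right a b := coe_subset.1 ((inf_subset a b).trans Set.inter_subset_right)
  le_inf a b c h1 h2 := coe_subset.1 (by
    calc (a : Set X) = closure (interior a) := a.closure_interior_coe.symm
      _ ⊆ _ := closure_mono (interior_mono
        (Set.subset_inter (coe_subset.2 h1) (coe_subset.2 h2))))
  le_sup_inf a b c := coe_subset.1 (by
    change closure (interior ((a ∪ b : Set X) ∩ (a ∪ c))) ⊆ a ∪ closure (interior (b ∩ c))
    apply closure_minimal _ (a.isClosed.union isClosed_closure)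
    intro x hx
    by_cases hxa : x ∈ (a : Set X)
    · exact Or.inl hxa
    · right
      apply subset_closure
      rw [mem_interior]
      refine ⟨interior ((a ∪ b : Set X) ∩ (a ∪ c)) ∩ (a : Set X)ᶜ, ?_,
        isOpen_interior.inter a.isClosed.isOpen_compl, hx, hxa⟩
      rintro y ⟨hy, hya⟩
      have := interior_subset hy
      exact ⟨this.1.resolve_left hya, this.2.resolve_left hya⟩)
  le_top a := coe_subset.1 (Set.subset_univ _)
  bot_le a := coe_subset.1 (Set.empty_subset _)
  inf_compl_le_bot a := coe_subset.1 (by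
    change closure (interior ((a : Set X) ∩ closure (a : Set X)ᶜ)) ⊆ ∅
    rw [interior_inter]
    refine Set.Subset.trans (closure_mono (t := ∅) ?_) closure_empty.subset
    rintro x ⟨hx, hx'⟩
    have := interior_subset hx'
    rw [closure_compl] at this
    exact this hx)
  top_le_sup_compl a := coe_subset.1 (by
    intro x _
    by_cases hx : x ∈ (a : Set X)
    · exact Or.inl hx
    · exact Or.inr (subset_closure hx))

end RegularClosed

/-! ### The category of dynamic contact algebras -/

/-- Dynamic contact algebras. -/
structure DCA : Type (u + 1) where
  carrier : Type u
  [booleanAlgebra : BooleanAlgebra carrier]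
  Cs : carrier → carrier → Prop
  Ct : carrier → carrier → Prop
  P : carrier → carrier → Prop
  isDCA : IsDCA Cs Ct P

namespace DCA

instance : CoeSort DCA.{u} (Type u) := ⟨carrier⟩

instance (A : DCA.{u}) : BooleanAlgebra A := A.booleanAlgebra

/-- Boolean homomorphisms (between Boolean algebras these are the bounded lattice homomorphisms)
reflecting the three relations. -/
@[ext]
structure Hom (A A' : DCA.{u}) where
  hom : BoundedLatticeHom A A'
  reflect_Cs : ∀ a b, A'.Cs (hom a) (hom b) → A.Cs a b
  reflect_Ct : ∀ a b, A'.Ct (hom a) (hom b) → A.Ct a b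
  reflect_P : ∀ a b, A'.P (hom a) (hom b) → A.P a b

instance : Category.{u} DCA.{u} where
  Hom := Hom
  id A := ⟨BoundedLatticeHom.id A, fun _ _ h => h, fun _ _ h => h, fun _ _ h => h⟩
  comp f g := ⟨g.hom.comp f.hom, fun _ _ h => f.reflect_Cs _ _ (g.reflect_Cs _ _ h),
    fun _ _ h => f.reflect_Ct _ _ (g.reflect_Ct _ _ h),
    fun _ _ h => f.reflect_P _ _ (g.reflect_P _ _ h)⟩

end DCA

/-! ### Dynamic mereotopological spaces -/

section SpaceRelations

variable {X : Type u} [TopologicalSpace X]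

/-- Time contact of regular closed sets: a common point. -/
def timeContact (a b : RegularClosed X) : Prop :=
  ((a : Set X) ∩ (b : Set X)).Nonempty

/-- Space contact of regular closed sets: a common space point. -/
def spaceContact (Xs : Set X) (a b : RegularClosed X) : Prop :=
  ((a : Set X) ∩ (b : Set X) ∩ Xs).Nonempty

/-- Precedence of regular closed sets. -/
def precedence (prec : X → X → Prop) (a b : RegularClosed X) : Prop :=
  ∃ x y, prec x y ∧ x ∈ a ∧ y ∈ b

/-- `ρ(x)`, the set of members of `M` that contain `x`. -/
def pointClan (M : BooleanSubalgebra (RegularClosed X)) (x : X) : Set M :=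
  {a | x ∈ (a : RegularClosed X)}

end SpaceRelations

/-- Dynamic mereotopological spaces: partial time points `carrier`, space points `Xs`,
time points `T`, before-after relation `prec`, regions `M`. -/
structure DMS : Type (u + 1) where
  carrier : Type u
  [topology : TopologicalSpace carrier]
  Xs : Set carrier
  T : Set carrier
  prec : carrier → carrier → Prop
  M : BooleanSubalgebra (RegularClosed carrier)
  nonempty : Nonempty carrier
  /-- `M` is a closed base: the set complements of its members form an open base. -/
  closedBase : TopologicalSpace.IsTopologicalBasis {U : Set carrier | ∃ a ∈ M, U = (a : Set carrier)ᶜ}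
  Xs_nonempty : Xs.Nonempty
  T_nonempty : T.Nonempty
  inter_Xs_nonempty : ∀ a : RegularClosed carrier,
    (a : Set carrier).Nonempty → ((a : Set carrier) ∩ Xs).Nonempty
  isDCA : IsDCA (B := M) (fun a b => spaceContact Xs a.1 b.1) (fun a b => timeContact a.1 b.1)
    (fun a b => precedence prec a.1 b.1)
  prec_iff : ∀ x y, prec x y ↔ ∀ a ∈ M, ∀ b ∈ M, x ∈ a → y ∈ b → precedence prec a b
  cluster_of_mem_T : ∀ x ∈ T, IsCluster (fun a b : M => timeContact a.1 b.1) (pointClan M x)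

namespace DMS

instance : CoeSort DMS.{u} (Type u) := ⟨carrier⟩

instance (S : DMS.{u}) : TopologicalSpace S := S.topology

/-- The dual algebra `S⁺`. -/
def dual (S : DMS.{u}) : DCA.{u} where
  carrier := S.M
  Cs a b := spaceContact S.Xs a.1 b.1
  Ct a b := timeContact a.1 b.1
  P a b := precedence S.prec a.1 b.1
  isDCA := S.isDCA

/-- A member of the algebra `S⁺` as a subset of `S`. -/
def region (S : DMS.{u}) (m : S.dual) : Set S := ((show S.M from m) : RegularClosed S)

/-- DM-compactness: every t-clan, s-clan and cluster of `S⁺` is `ρ(x)` for a partial time point,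
a space point and a time point `x`, respectively. -/
structure DMCompact (S : DMS.{u}) : Prop where
  tClan : ∀ Γ, IsClan S.dual.Ct Γ → ∃ x : S, Γ = pointClan S.M x
  sClan : ∀ Γ, IsClan S.dual.Cs Γ → ∃ x ∈ S.Xs, Γ = pointClan S.M x
  cluster : ∀ Γ, IsCluster S.dual.Ct Γ → ∃ x ∈ S.T, Γ = pointClan S.M x

/-- DMS-morphisms. The last field says that preimages of regions are regions and that taking
preimages is a Boolean homomorphism between the algebras of regions. -/
@[ext]
structure Hom (S S' : DMS.{u}) where
  toFun : S → S'
  map_Xs : ∀ x ∈ S.Xs, toFun x ∈ S'.Xs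
  map_prec : ∀ x y, S.prec x y → S'.prec (toFun x) (toFun y)
  preimage_hom : ∃ h : BoundedLatticeHom S'.M S.M,
    ∀ a : S'.M, ((h a : RegularClosed S) : Set S) = toFun ⁻¹' ((a : RegularClosed S') : Set S')

instance : Category.{u} DMS.{u} where
  Hom := Hom
  id S := ⟨id, fun _ h => h, fun _ _ h => h, BoundedLatticeHom.id _, fun _ => rfl⟩
  comp f g := ⟨g.toFun ∘ f.toFun, fun _ h => g.map_Xs _ (f.map_Xs _ h),
    fun _ _ h => g.map_prec _ _ (f.map_prec _ _ h), by
      obtain ⟨h, hh⟩ := f.preimage_hom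
      obtain ⟨k, hk⟩ := g.preimage_hom
      refine ⟨h.comp k, fun a => ?_⟩
      rw [BoundedLatticeHom.comp_apply, hh, hk]
      rfl⟩

/-- The Boolean homomorphism `θ⁻¹`. -/
noncomputable def Hom.preimage {S S' : DMS.{u}} (θ : Hom S S') : BoundedLatticeHom S'.M S.M :=
  θ.preimage_hom.choose

theorem Hom.coe_preimage {S S' : DMS.{u}} (θ : Hom S S') (a : S'.M) :
    ((θ.preimage a : RegularClosed S) : Set S)
      = θ.toFun ⁻¹' ((a : RegularClosed S') : Set S') :=
  θ.preimage_hom.choose_spec a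

theorem Hom.mem_preimage {S S' : DMS.{u}} (θ : Hom S S') (a : S'.M) (x : S) :
    x ∈ (θ.preimage a : RegularClosed S) ↔ θ.toFun x ∈ (a : RegularClosed S') :=
  Set.ext_iff.1 (θ.coe_preimage a) x

/-- The DCA-morphism `θ⁺ = θ⁻¹`. -/
noncomputable def Hom.dual {S S' : DMS.{u}} (θ : Hom S S') : DCA.Hom S'.dual S.dual where
  hom := θ.preimage
  reflect_Cs a b := by
    rintro ⟨x, ⟨hx, hy⟩, hs⟩
    exact ⟨θ.toFun x, ⟨(θ.mem_preimage a x).1 hx, (θ.mem_preimage b x).1 hy⟩, θ.map_Xs _ hs⟩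
  reflect_Ct a b := by
    rintro ⟨x, hx, hy⟩
    exact ⟨θ.toFun x, (θ.mem_preimage a x).1 hx, (θ.mem_preimage b x).1 hy⟩
  reflect_P a b := by
    rintro ⟨x, y, hxy, hx, hy⟩
    exact ⟨θ.toFun x, θ.toFun y, θ.map_prec _ _ hxy, (θ.mem_preimage a x).1 hx,
      (θ.mem_preimage b y).1 hy⟩

end DMS

/-- The contravariant functor `S ↦ S⁺`, `θ ↦ θ⁻¹`. -/
noncomputable def dualAlgebra : DMS.{u}ᵒᵖ ⥤ DCA.{u} where
  obj S := S.unop.dual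
  map θ := DMS.Hom.dual θ.unop
  map_id S := by
    apply DCA.Hom.ext
    ext a : 1
    apply Subtype.ext
    apply SetLike.coe_injective
    exact DMS.Hom.coe_preimage (𝟙 S.unop : S.unop ⟶ S.unop) a
  map_comp {S S' S''} θ η := by
    apply DCA.Hom.ext
    ext a : 1
    apply Subtype.ext
    apply SetLike.coe_injective
    refine (DMS.Hom.coe_preimage (η.unop ≫ θ.unop : S''.unop ⟶ S.unop) a).trans ?_
    refine Eq.trans ?_ (DMS.Hom.coe_preimage η.unop (DMS.Hom.preimage θ.unop a)).symm
    rw [DMS.Hom.coe_preimage θ.unop a]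
    rfl

/-- The full subcategory of T0, DM-compact dynamic mereotopological spaces. -/
abbrev DMSStar : Type (u + 1) :=
  ObjectProperty.FullSubcategory (fun S : DMS.{u} => T0Space S ∧ S.DMCompact)

/-- The functor `S ↦ S⁺`, `θ ↦ θ⁻¹` on T0, DM-compact spaces. -/
noncomputable def dualAlgebraStar : DMSStar.{u}ᵒᵖ ⥤ DCA.{u} :=
  (ObjectProperty.ι _).op ⋙ dualAlgebra

/-! ### The dual space of a dynamic contact algebra -/

namespace DCA

variable (A : DCA.{u})

/-- The t-clans of `A`. -/
abbrev TClan : Type u := {Γ : Set A // IsClan A.Ct Γ}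

/-- `g(a)`, the set of t-clans containing `a`. -/
def g (a : A) : Set A.TClan := {Γ | a ∈ Γ.1}

/-- The topology on the t-clans with closed base the sets `g(a)`. -/
instance : TopologicalSpace A.TClan :=
  TopologicalSpace.generateFrom {U | ∃ a, U = (A.g a)ᶜ}

/-- Precedence of t-clans. -/
def clanPrec (Γ Δ : A.TClan) : Prop := ∀ a b, a ∈ Γ.1 → b ∈ Δ.1 → A.P a b

variable {A}

theorem g_sup (a b : A) : A.g (a ⊔ b) = A.g a ∪ A.g b := by
  ext Γ
  exact ⟨Γ.2.prime a b, fun h => h.elim (fun h => Γ.2.upward _ _ h le_sup_left)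
    (fun h => Γ.2.upward _ _ h le_sup_right)⟩

theorem g_top : A.g ⊤ = Set.univ := Set.eq_univ_of_forall fun Γ => Γ.2.top_mem

theorem g_bot : A.g ⊥ = ∅ := Set.eq_empty_of_forall_notMem fun Γ => Γ.2.bot_notMem

/-- An ultrafilter as a t-clan. -/
theorem exists_sClan_of_ne_bot {a : A} (ha : a ≠ ⊥) :
    ∃ Γ : A.TClan, IsClan A.Cs Γ.1 ∧ a ∈ Γ.1 ∧ ∀ b ∈ Γ.1, a ⊓ b ≠ ⊥ := by
  obtain ⟨U, hU, hUi, haU, -⟩ := (isGrill_nonzero A.isDCA.bot_ne_top).exists_ultra_mem ha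
  exact ⟨⟨U, A.isDCA.time.isClan_of_ultra hU hUi⟩, A.isDCA.space.isClan_of_ultra hU hUi, haU,
    fun b hb h => hU.bot_notMem (h ▸ hUi _ _ haU hb)⟩

theorem g_subset_iff {a b : A} : A.g a ⊆ A.g b ↔ a ≤ b := by
  refine ⟨fun h => ?_, fun h Γ hΓ => Γ.2.upward _ _ hΓ h⟩
  by_contra hab
  have hne : a ⊓ bᶜ ≠ ⊥ := fun h' => hab (by rwa [← disjoint_iff, disjoint_compl_right_iff] at h')
  obtain ⟨Γ, -, hΓ, hΓ'⟩ := exists_sClan_of_ne_bot hne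
  have hb : b ∈ Γ.1 := h (show a ∈ Γ.1 from Γ.2.upward _ _ hΓ inf_le_left)
  exact hΓ' b hb (by rw [inf_assoc, compl_inf_eq_bot, inf_bot_eq])

theorem g_injective : Function.Injective A.g := fun _ _ h =>
  le_antisymm (g_subset_iff.1 h.subset) (g_subset_iff.1 h.superset)

theorem isTopologicalBasis_g :
    TopologicalSpace.IsTopologicalBasis {U : Set A.TClan | ∃ a, U = (A.g a)ᶜ} where
  exists_subset_inter := by
    rintro _ ⟨a, rfl⟩ _ ⟨b, rfl⟩ Γ hΓ
    refine ⟨_, ⟨a ⊔ b, rfl⟩, ?_, ?_⟩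
    · rw [g_sup, Set.compl_union]; exact hΓ
    · rw [g_sup, Set.compl_union]
  sUnion_eq := Set.eq_univ_of_forall fun Γ =>
    ⟨_, ⟨⊥, rfl⟩, by rw [g_bot, Set.compl_empty]; trivial⟩
  eq_generateFrom := rfl

theorem isClosed_g (a : A) : IsClosed (A.g a) :=
  ⟨isTopologicalBasis_g.isOpen ⟨a, rfl⟩⟩

theorem closure_compl_g (a : A) : closure (A.g a)ᶜ = A.g aᶜ := by
  apply subset_antisymm
  · apply closure_minimal _ (isClosed_g _)
    intro Γ hΓ
    have : a ⊔ aᶜ ∈ Γ.1 := by rw [sup_compl_eq_top]; exact Γ.2.top_mem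
    exact (Γ.2.prime _ _ this).resolve_left hΓ
  · intro Γ hΓ
    rw [isTopologicalBasis_g.mem_closure_iff]
    rintro _ ⟨b, rfl⟩ hb
    by_contra hc
    rw [Set.not_nonempty_iff_eq_empty, ← Set.compl_union, Set.compl_empty_iff, ← g_sup,
      ← g_top] at hc
    exact hb ((Γ.2.compl_mem_iff a).1 hΓ b (by rw [sup_comm]; exact g_injective hc))

theorem closure_interior_g (a : A) : closure (interior (A.g a)) = A.g a := by
  have : interior (A.g a) = (A.g aᶜ)ᶜ := by
    rw [← closure_compl_g, closure_compl, compl_compl]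
  rw [this, closure_compl_g, compl_compl]

/-- `g(a)` as a regular closed set. -/
def gRC (a : A) : RegularClosed A.TClan := ⟨A.g a, closure_interior_g a⟩

theorem mem_gRC {a : A} {Γ : A.TClan} : Γ ∈ gRC a ↔ a ∈ Γ.1 := Iff.rfl

theorem gRC_sup (a b : A) : gRC (a ⊔ b) = gRC a ⊔ gRC b :=
  SetLike.coe_injective (g_sup a b)

theorem gRC_compl (a : A) : gRC aᶜ = (gRC a)ᶜ :=
  SetLike.coe_injective (closure_compl_g a).symm

theorem gRC_inf (a b : A) : gRC (a ⊓ b) = gRC a ⊓ gRC b := by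
  rw [← compl_inj_iff, ← gRC_compl, compl_inf, gRC_sup, compl_inf, gRC_compl, gRC_compl]

variable (A) in
/-- The algebra of all `g(a)`. -/
def regions : BooleanSubalgebra (RegularClosed A.TClan) where
  carrier := Set.range gRC
  supClosed' := by
    rintro _ ⟨a, rfl⟩ _ ⟨b, rfl⟩
    exact ⟨a ⊔ b, gRC_sup a b⟩
  infClosed' := by
    rintro _ ⟨a, rfl⟩ _ ⟨b, rfl⟩
    exact ⟨a ⊓ b, gRC_inf a b⟩
  compl_mem' := by
    rintro _ ⟨a, rfl⟩
    exact ⟨aᶜ, gRC_compl a⟩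
  bot_mem' := ⟨⊥, SetLike.coe_injective g_bot⟩

variable (A) in
/-- `g` as a Boolean homomorphism onto the algebra of regions. -/
def gHom : BoundedLatticeHom A A.regions where
  toFun a := ⟨gRC a, a, rfl⟩
  map_sup' a b := Subtype.ext (gRC_sup a b)
  map_inf' a b := Subtype.ext (gRC_inf a b)
  map_top' := Subtype.ext (SetLike.coe_injective g_top)
  map_bot' := Subtype.ext (SetLike.coe_injective g_bot)

theorem gHom_surjective : Function.Surjective A.gHom := by
  rintro ⟨_, a, rfl⟩
  exact ⟨a, rfl⟩

theorem gHom_injective : Function.Injective A.gHom := fun _ _ h =>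
  g_injective (congrArg (fun m : A.regions => ((m : RegularClosed A.TClan) : Set A.TClan)) h)

variable (A) in
/-- The s-clans, as a set of t-clans. -/
def sClans : Set A.TClan := {Γ | IsClan A.Cs Γ.1}

theorem timeContact_gHom (a b : A) :
    timeContact (A.gHom a).1 (A.gHom b).1 ↔ A.Ct a b := by
  constructor
  · rintro ⟨Γ, ha, hb⟩
    exact Γ.2.contact _ _ ha hb
  · intro h
    obtain ⟨Γ, hΓ, ha, hb⟩ := A.isDCA.time.exists_clan h
    exact ⟨⟨Γ, hΓ⟩, ha, hb⟩

theorem isClan_Ct_of_Cs {Γ : Set A} (h : IsClan A.Cs Γ) : IsClan A.Ct Γ where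
  toIsGrill := h.toIsGrill
  contact a b ha hb := A.isDCA.time_of_space _ _ (h.contact a b ha hb)

theorem spaceContact_gHom (a b : A) :
    spaceContact A.sClans (A.gHom a).1 (A.gHom b).1 ↔ A.Cs a b := by
  constructor
  · rintro ⟨Γ, ⟨ha, hb⟩, hs⟩
    exact IsClan.contact hs _ _ ha hb
  · intro h
    obtain ⟨Γ, hΓ, ha, hb⟩ := A.isDCA.space.exists_clan h
    exact ⟨⟨Γ, isClan_Ct_of_Cs hΓ⟩, ⟨ha, hb⟩, hΓ⟩

theorem precedence_gHom (a b : A) :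
    precedence A.clanPrec (A.gHom a).1 (A.gHom b).1 ↔ A.P a b := by
  constructor
  · rintro ⟨Γ, Δ, h, ha, hb⟩
    exact h _ _ ha hb
  · intro h
    obtain ⟨U, V, hU, hUi, hV, hVi, ha, hb, hUV⟩ := A.isDCA.prec.exists_ultra h
    exact ⟨⟨U, A.isDCA.time.isClan_of_ultra hU hUi⟩, ⟨V, A.isDCA.time.isClan_of_ultra hV hVi⟩,
      hUV, ha, hb⟩

/-- The axioms of precontact relations transfer along isomorphisms. -/
theorem _root_.IsPrecontact.transfer {B B' : Type u} [BooleanAlgebra B] [BooleanAlgebra B']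
    {C : B → B → Prop} {C' : B' → B' → Prop} (f : B ≃o B')
    (hf : ∀ a b, C' (f a) (f b) ↔ C a b) (hC : IsPrecontact C) : IsPrecontact C' := by
  have hs : ∀ x, ∃ a, f a = x := f.surjective
  refine ⟨?_, ?_, ?_, ?_⟩ <;> simp only [f.surjective.forall, hf, ← map_sup, f.le_iff_le, ne_eq,
    map_eq_bot_iff]
  · exact hC.ne_bot
  · exact hC.mono
  · exact hC.sup_right
  · exact hC.sup_left

theorem _root_.IsContact.transfer {B B' : Type u} [BooleanAlgebra B] [BooleanAlgebra B']
    {C : B → B → Prop} {C' : B' → B' → Prop} (f : B ≃o B')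
    (hf : ∀ a b, C' (f a) (f b) ↔ C a b) (hC : IsContact C) : IsContact C' := by
  refine ⟨hC.toIsPrecontact.transfer f hf, ?_, ?_⟩ <;>
    simp only [f.surjective.forall, hf, ← map_inf, ne_eq, map_eq_bot_iff]
  · exact hC.symm
  · exact hC.of_inf_ne_bot

theorem _root_.IsDCA.transfer {B B' : Type u} [BooleanAlgebra B] [BooleanAlgebra B']
    {Cs Ct P : B → B → Prop} {Cs' Ct' P' : B' → B' → Prop} (f : B ≃o B')
    (hs : ∀ a b, Cs' (f a) (f b) ↔ Cs a b) (ht : ∀ a b, Ct' (f a) (f b) ↔ Ct a b)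
    (hp : ∀ a b, P' (f a) (f b) ↔ P a b) (h : IsDCA Cs Ct P) : IsDCA Cs' Ct' P' := by
  refine ⟨?_, h.space.transfer f hs, h.time.transfer f ht, ?_, ?_, h.prec.transfer f hp, ?_, ?_⟩
  · rw [← map_bot f, ← map_top f]
    exact fun h' => h.bot_ne_top (f.injective h')
  all_goals simp only [f.surjective.forall, f.surjective.exists, hs, ht, hp, ← map_compl]
  · exact h.time_of_space
  · exact h.time_efremovich
  · exact h.time_prec
  · exact h.prec_time

variable (A) in
/-- `g` as an order isomorphism onto the algebra of regions. -/
noncomputable def gIso : A ≃o A.regions where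
  toEquiv := Equiv.ofBijective A.gHom ⟨gHom_injective, gHom_surjective⟩
  map_rel_iff' := g_subset_iff

theorem isDCA_regions : IsDCA (B := A.regions) (fun a b => spaceContact A.sClans a.1 b.1)
    (fun a b => timeContact a.1 b.1) (fun a b => precedence A.clanPrec a.1 b.1) :=
  A.isDCA.transfer A.gIso spaceContact_gHom timeContact_gHom precedence_gHom

theorem inter_sClans_nonempty (α : RegularClosed A.TClan) (h : (α : Set A.TClan).Nonempty) :
    ((α : Set A.TClan) ∩ A.sClans).Nonempty := by
  obtain ⟨Γ, hΓ⟩ := h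
  obtain ⟨U, hU, hUi, hFU, -⟩ := Γ.2.toIsGrill.exists_ultra {a | α ≤ gRC a}
    (fun Δ _ => Δ.2.top_mem)
    (fun a b ha hab Δ hΔ => Δ.2.upward _ _ (ha hΔ) hab)
    (fun a b ha hb => by
      change α ≤ gRC (a ⊓ b)
      rw [gRC_inf]
      exact le_inf ha hb)
    (fun a ha => ha hΓ)
  refine ⟨⟨U, A.isDCA.time.isClan_of_ultra hU hUi⟩, ?_, A.isDCA.space.isClan_of_ultra hU hUi⟩
  by_contra hc
  obtain ⟨_, ⟨a, rfl⟩, ha, haα⟩ :=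
    isTopologicalBasis_g.exists_subset_of_mem_open hc α.isClosed.isOpen_compl
  exact ha (hFU (Set.compl_subset_compl.1 haα))

/-- The map `ρ` of the dual space is inverse to pulling back along `g`. -/
theorem preimage_gHom_pointClan (Γ : A.TClan) : A.gHom ⁻¹' (pointClan A.regions Γ) = Γ.1 := rfl

theorem isCluster_pointClan (Γ : A.TClan) (hΓ : IsCluster A.Ct Γ.1) :
    IsCluster (fun a b : A.regions => timeContact a.1 b.1) (pointClan A.regions Γ) where
  top_mem := Set.mem_univ Γ
  bot_notMem := Set.notMem_empty Γ
  upward a b ha hab := hab ha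
  prime a b hab := hab
  contact a b ha hb := ⟨Γ, ha, hb⟩
  cluster m hm := by
    obtain ⟨a, rfl⟩ := gHom_surjective m
    obtain ⟨b, hb, hab⟩ := hΓ.cluster a hm
    exact ⟨A.gHom b, hb, fun h => hab ((timeContact_gHom a b).1 h)⟩

variable (A) in
/-- The dual space `A₊`. -/
def dual : DMS.{u} where
  carrier := A.TClan
  Xs := A.sClans
  T := {Γ | IsCluster A.Ct Γ.1}
  prec := A.clanPrec
  M := A.regions
  nonempty := by
    obtain ⟨Γ, hΓ⟩ := A.isDCA.exists_cluster
    exact ⟨⟨Γ, hΓ.toIsClan⟩⟩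
  closedBase := by
    have h : {U : Set A.TClan | ∃ a ∈ A.regions, U = (a : Set A.TClan)ᶜ} =
        {U | ∃ a, U = (A.g a)ᶜ} := by
      ext U
      constructor
      · rintro ⟨_, ⟨a, rfl⟩, rfl⟩
        exact ⟨a, rfl⟩
      · rintro ⟨a, rfl⟩
        exact ⟨gRC a, ⟨a, rfl⟩, rfl⟩
    rw [h]
    exact isTopologicalBasis_g
  Xs_nonempty := by
    obtain ⟨Γ, hΓ, -⟩ := exists_sClan_of_ne_bot (A := A) A.isDCA.bot_ne_top.symm
    exact ⟨Γ, hΓ⟩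
  T_nonempty := by
    obtain ⟨Γ, hΓ⟩ := A.isDCA.exists_cluster
    exact ⟨⟨Γ, hΓ.toIsClan⟩, hΓ⟩
  inter_Xs_nonempty := inter_sClans_nonempty
  isDCA := isDCA_regions
  prec_iff Γ Δ := by
    constructor
    · intro h a _ b _ ha hb
      exact ⟨Γ, Δ, h, ha, hb⟩
    · intro h a b ha hb
      exact (precedence_gHom a b).1 (h _ ⟨a, rfl⟩ _ ⟨b, rfl⟩ ha hb)
  cluster_of_mem_T := isCluster_pointClan

theorem t0Space_dual : T0Space A.dual := by
  refine ⟨fun {Γ} {Δ} h => ?_⟩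
  apply Subtype.ext
  ext a
  exact (inseparable_iff_forall_isClosed.1 h) (A.g a) (isClosed_g a)

theorem eq_pointClan {Γ : Set A.regions} {Δ : A.TClan} (h : A.gHom ⁻¹' Γ = Δ.1) :
    Γ = pointClan A.regions Δ := by
  apply gHom_surjective.preimage_injective
  rw [h, preimage_gHom_pointClan]

theorem dmCompact_dual : A.dual.DMCompact where
  tClan Γ hΓ := by
    have h : IsClan A.Ct (A.gHom ⁻¹' Γ) := hΓ.comap A.gHom fun a b => (timeContact_gHom a b).1
    exact ⟨⟨_, h⟩, eq_pointClan rfl⟩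
  sClan Γ hΓ := by
    have h : IsClan A.Cs (A.gHom ⁻¹' Γ) := hΓ.comap A.gHom fun a b => (spaceContact_gHom a b).1
    exact ⟨⟨_, isClan_Ct_of_Cs h⟩, h, eq_pointClan rfl⟩
  cluster Γ hΓ := by
    have h : IsClan A.Ct (A.gHom ⁻¹' Γ) :=
      hΓ.toIsClan.comap A.gHom fun a b => (timeContact_gHom a b).1
    refine ⟨⟨_, h⟩, ⟨h, fun a ha => ?_⟩, eq_pointClan rfl⟩
    obtain ⟨m, hm, ham⟩ := hΓ.cluster (A.gHom a) ha
    obtain ⟨b, rfl⟩ := gHom_surjective m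
    exact ⟨b, hm, fun hab => ham ((timeContact_gHom a b).2 hab)⟩

/-- The DMS-morphism `f₊`, sending a t-clan `Γ` to `f⁻¹(Γ)`. -/
def Hom.dual {A A' : DCA.{u}} (f : Hom A A') : DMS.Hom A'.dual A.dual where
  toFun Γ := ⟨f.hom ⁻¹' Γ.1, Γ.2.comap f.hom f.reflect_Ct⟩
  map_Xs _ hΓ := IsClan.comap f.hom f.reflect_Cs hΓ
  map_prec _ _ h := fun a b ha hb => f.reflect_P a b (h _ _ ha hb)
  preimage_hom := by
    refine ⟨(A'.gHom.comp f.hom).comp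
      ((A.gIso.symm : A.regions ≃o A) : BoundedLatticeHom A.regions A), fun m => ?_⟩
    obtain ⟨a, rfl⟩ := A.gIso.surjective m
    change A'.g (f.hom (A.gIso.symm (A.gIso a))) = _
    rw [OrderIso.symm_apply_apply]
    rfl

end DCA

/-- The contravariant functor `A ↦ A₊`, `f ↦ f⁻¹`. -/
def dualSpace : DCA.{u}ᵒᵖ ⥤ DMSStar.{u} where
  obj A := ⟨A.unop.dual, DCA.t0Space_dual, DCA.dmCompact_dual⟩
  map f := ObjectProperty.homMk (DCA.Hom.dual f.unop)
  map_id _ := rfl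
  map_comp _ _ := rfl

/-! The duality is of Stone type, with clans as points, and both natural isomorphisms come from the
equivalence between `a ∈ Γ` and `Γ ∈ g(a)`.

On the algebraic side, ultrafilters provide enough clans. If `a ≰ b`, an ultrafilter containing `a ⊓
bᶜ` separates `g(a)` from `g(b)`, so `g` is a Boolean isomorphism onto the regions of the dual
space. Elements in contact lie in two ultrafilters whose union is a clan, and elements in precedence
lie in ultrafilters that precede one another. Hence `g` preserves the three relations as well as
reflecting them (`spaceContact_gHom`, `timeContact_gHom`, `precedence_gHom`), which makes it an
isomorphism of DCAs.

On the spatial side, the regions containing a point form a t-clan. The map `ρ` is injective by T0,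
since the regions are a closed base (`toTClan_injective`), and surjective by DM-compactness
(`DMCompact.toTClan_surjective`). It matches `≺` with precedence of clans by the axiom `prec_iff`
(`clanPrec_toTClan`), and DM-compactness for s-clans makes `ρ⁻¹` preserve space points. Morphisms
carry no condition on time points, so these need no separate argument here.

Naturality and the triangle identity then unfold to statements about membership. -/

/-! ### The isomorphism `g` from a dynamic contact algebra to its double dual -/

namespace DCA

variable (A : DCA.{u})

theorem gHom_gIso_symm (m : A.regions) : A.gHom (A.gIso.symm m) = m :=
  A.gIso.apply_symm_apply m

theorem gIso_symm_gHom (a : A) : A.gIso.symm (A.gHom a) = a :=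
  A.gIso.symm_apply_apply a

/-- `g` as an isomorphism of dynamic contact algebras from `A` onto `(A₊)⁺`. -/
noncomputable def isoDualDual : A ≅ A.dual.dual where
  hom := (⟨A.gHom, fun a b => (spaceContact_gHom a b).1, fun a b => (timeContact_gHom a b).1,
    fun a b => (precedence_gHom a b).1⟩ : Hom A A.dual.dual)
  inv := (⟨((A.gIso.symm : A.regions ≃o A) : BoundedLatticeHom A.regions A),
    -- Morphisms only reflect the relations, so a bijective one need not be invertible. That the
    -- inverse reflects them means that `g` preserves them, which is the direction relying on the
    -- existence of enough clans.
    A.gIso.surjective.forall₂.2 fun a b h => (spaceContact_gHom a b).2 (by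
      change A.Cs (A.gIso.symm (A.gIso a)) (A.gIso.symm (A.gIso b)) at h
      rwa [OrderIso.symm_apply_apply, OrderIso.symm_apply_apply] at h),
    A.gIso.surjective.forall₂.2 fun a b h => (timeContact_gHom a b).2 (by
      change A.Ct (A.gIso.symm (A.gIso a)) (A.gIso.symm (A.gIso b)) at h
      rwa [OrderIso.symm_apply_apply, OrderIso.symm_apply_apply] at h),
    A.gIso.surjective.forall₂.2 fun a b h => (precedence_gHom a b).2 (by
      change A.P (A.gIso.symm (A.gIso a)) (A.gIso.symm (A.gIso b)) at h
      rwa [OrderIso.symm_apply_apply, OrderIso.symm_apply_apply] at h)⟩ : Hom A.dual.dual A)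
  hom_inv_id := Hom.ext (DFunLike.ext _ _ A.gIso_symm_gHom)
  inv_hom_id := Hom.ext (DFunLike.ext _ _ A.gHom_gIso_symm)

/-- Both composites send `a` to the set of t-clans `Γ` with `f(a) ∈ Γ`. Since `Hom.preimage` is
obtained by choice, the comparison is made on underlying sets, through `coe_preimage`. -/
theorem isoDualDual_naturality {A A' : DCA.{u}} (f : A ⟶ A') :
    f ≫ A'.isoDualDual.hom = A.isoDualDual.hom ≫ DMS.Hom.dual (Hom.dual f) := by
  refine Hom.ext (DFunLike.ext _ _ fun a => Subtype.ext (SetLike.coe_injective ?_))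
  exact (DMS.Hom.coe_preimage (Hom.dual f) (A.gHom a)).symm

end DCA

/-! ### The isomorphism `ρ` from a T0, DM-compact space to its double dual -/

namespace DMS

variable {S : DMS.{u}}

/-- Joins of regions are unions, which gives primeness, and `x` itself witnesses contact. Meets can
be smaller than intersections, so in general this is a clan and not an ultrafilter. -/
theorem isClan_pointClan (x : S) : IsClan S.dual.Ct (pointClan S.M x) where
  top_mem := Set.mem_univ x
  bot_notMem := Set.notMem_empty x
  upward _ _ ha hab := hab ha
  prime _ _ hab := hab
  contact _ _ ha hb := ⟨x, ha, hb⟩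

theorem isClan_Cs_pointClan {x : S} (hx : x ∈ S.Xs) : IsClan S.dual.Cs (pointClan S.M x) where
  toIsGrill := (isClan_pointClan x).toIsGrill
  contact _ _ ha hb := ⟨x, ⟨ha, hb⟩, hx⟩

/-- The map `ρ`, from points to t-clans. -/
def toTClan (x : S) : S.dual.TClan := ⟨pointClan S.M x, isClan_pointClan x⟩

theorem clanPrec_toTClan {x y : S} :
    S.dual.clanPrec (toTClan x) (toTClan y) ↔ S.prec x y :=
  ⟨fun h => (S.prec_iff x y).2 fun a ha b hb hx hy => h ⟨a, ha⟩ ⟨b, hb⟩ hx hy,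
    fun h a b hx hy => (S.prec_iff x y).1 h a.1 a.2 b.1 b.2 hx hy⟩

/-- In a T0 space, points are determined by the regions containing them. -/
theorem toTClan_injective [T0Space S] : Function.Injective (toTClan (S := S)) := by
  intro x y h
  -- Complements of regions form an open base, so points lying in the same regions are inseparable,
  -- hence equal by T0.
  refine (S.closedBase.inseparable_iff.2 ?_).eq
  rintro _ ⟨a, ha, rfl⟩
  exact not_congr (Set.ext_iff.1 (congrArg Subtype.val h) ⟨a, ha⟩)

theorem DMCompact.toTClan_surjective (hS : S.DMCompact) :
    Function.Surjective (toTClan (S := S)) := by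
  rintro ⟨Γ, hΓ⟩
  obtain ⟨x, hx⟩ := hS.tClan Γ hΓ
  exact ⟨x, Subtype.ext hx.symm⟩

/-- `ρ` as a bijection from the points of a T0, DM-compact space onto the t-clans. -/
noncomputable def equivTClan [T0Space S] (hS : S.DMCompact) : S ≃ S.dual.TClan :=
  Equiv.ofBijective toTClan ⟨toTClan_injective, hS.toTClan_surjective⟩

theorem toTClan_equivTClan_symm [T0Space S] (hS : S.DMCompact) (Γ : S.dual.TClan) :
    toTClan ((equivTClan hS).symm Γ) = Γ :=
  (equivTClan hS).apply_symm_apply Γ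

/-- `ρ` as an isomorphism of dynamic mereotopological spaces from `S` onto `(S⁺)₊`. -/
noncomputable def isoDualDual [T0Space S] (hS : S.DMCompact) : S ≅ S.dual.dual where
  hom := (
    { toFun := toTClan
      map_Xs := fun _ => isClan_Cs_pointClan
      map_prec := fun _ _ => clanPrec_toTClan.2
      preimage_hom := by
        refine ⟨((S.dual.gIso.symm : S.dual.regions ≃o S.dual) :
          BoundedLatticeHom S.dual.regions S.dual), S.dual.gIso.surjective.forall.2 fun a => ?_⟩
        -- The preimage of `g(a)` under `ρ` consists of the `x` with `a ∈ ρ(x)`, which is `a`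
        -- itself; so taking preimages is the inverse of `g`.
        exact congrArg S.region (S.dual.gIso_symm_gHom a) } : Hom S S.dual.dual)
  inv := (
    { toFun := (equivTClan hS).symm
      map_Xs := fun Γ hΓ => by
        -- DM-compactness yields a space point representing the s-clan; as `ρ` is a bijection, it is
        -- the value of the inverse at `Γ`.
        obtain ⟨x, hx, hxΓ⟩ := hS.sClan Γ.1 hΓ
        rwa [(equivTClan hS).symm_apply_eq.2 (show Γ = toTClan x from Subtype.ext hxΓ)]
      map_prec := (equivTClan hS).surjective.forall₂.2 fun x y h => by
        rw [Equiv.symm_apply_apply, Equiv.symm_apply_apply]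
        exact clanPrec_toTClan.1 h
      preimage_hom := by
        -- With `Γ = ρ(x)`, the conditions `x ∈ a` and `a ∈ Γ` coincide, so the preimage of `a`
        -- under `ρ⁻¹` is `g(a)`.
        refine ⟨S.dual.gHom, fun a => Set.ext fun Γ => ?_⟩
        exact Set.ext_iff.1 (congrArg Subtype.val (toTClan_equivTClan_symm hS Γ).symm) a } : Hom S.dual.dual S)
  hom_inv_id := Hom.ext (funext (equivTClan hS).symm_apply_apply)
  inv_hom_id := Hom.ext (funext (equivTClan hS).apply_symm_apply)

/-- A region `a` contains `θ(x)` exactly when `θ⁻¹(a)` contains `x`. -/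
theorem toTClan_naturality {S S' : DMS.{u}} (θ : S ⟶ S') (x : S) :
    toTClan (Hom.toFun θ x) = (DCA.Hom.dual (Hom.dual θ)).toFun (toTClan x) :=
  Subtype.ext (Set.ext fun a => (Hom.mem_preimage θ a x).symm)

end DMS

/-! ### Assembling the dual equivalence -/

/-- The natural isomorphism `g`, in the opposite category. -/
noncomputable def dualityUnit : 𝟭 DCA.{u}ᵒᵖ ≅ dualSpace ⋙ dualAlgebraStar.rightOp :=
  -- In the opposite category `g` points from the double dual to the identity. The isomorphism is
  -- built in that direction, where naturality concerns `g` rather than its inverse, and then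
  -- reversed.
  (NatIso.ofComponents (F := dualSpace ⋙ dualAlgebraStar.rightOp) (G := 𝟭 DCA.{u}ᵒᵖ)
    (fun A => A.unop.isoDualDual.op)
    fun f => Quiver.Hom.unop_inj (DCA.isoDualDual_naturality f.unop).symm).symm

/-- The natural isomorphism `ρ`. -/
noncomputable def dualityCounit : dualAlgebraStar.rightOp ⋙ dualSpace ≅ 𝟭 DMSStar.{u} :=
  (NatIso.ofComponents (F := 𝟭 DMSStar.{u}) (G := dualAlgebraStar.rightOp ⋙ dualSpace)
    (fun S => haveI : T0Space S.obj := S.property.1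
      ObjectProperty.isoMk _ (DMS.isoDualDual (S := S.obj) S.property.2))
    fun θ => ObjectProperty.hom_ext _
      (DMS.Hom.ext (funext (DMS.toTClan_naturality θ.hom)))).symm

/-- The unit is `g⁻¹` and the counit `ρ⁻¹`. The identity says that pulling `Γ` back along `g⁻¹`
gives `ρ(Γ)`: the element `a` represented by a region `g(a)` lies in `Γ` exactly when `Γ` lies in
`g(a)`. -/
theorem duality_triangle (A : DCA.{u}ᵒᵖ) :
    dualSpace.map (dualityUnit.hom.app A) ≫ dualityCounit.hom.app (dualSpace.obj A) =
      𝟙 (dualSpace.obj A) := by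
  -- Composing with `ρ` removes `ρ⁻¹`, which has no explicit formula.
  rw [← cancel_mono (dualityCounit.inv.app (dualSpace.obj A)), Category.assoc,
    Iso.hom_inv_id_app]
  refine (Category.comp_id _).trans (Eq.trans ?_ (Category.id_comp _).symm)
  refine ObjectProperty.hom_ext _ (DMS.Hom.ext (funext fun Γ => Subtype.ext (Set.ext ?_)))
  refine A.unop.gIso.surjective.forall.2 fun a => ?_
  exact iff_of_eq (congrArg (· ∈ Subtype.val (p := IsClan A.unop.Ct) Γ) (A.unop.gIso_symm_gHom a))

/-- The equation for `e` fixes the two functors and the two transformations, and the last two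
clauses identify the latter with `g` and `ρ`. One triangle identity suffices, since the other
follows from it for an equivalence. -/
theorem mainTheorem4 :
    ∃ (η : 𝟭 DCA.{u}ᵒᵖ ≅ dualSpace ⋙ dualAlgebraStar.rightOp)
      (ε : dualAlgebraStar.rightOp ⋙ dualSpace ≅ 𝟭 DMSStar.{u})
      (triangle : ∀ A, dualSpace.map (η.hom.app A) ≫ ε.hom.app (dualSpace.obj A) =
        𝟙 (dualSpace.obj A))
      (e : DCA.{u}ᵒᵖ ≌ DMSStar.{u}),
      e = { functor := dualSpace
            inverse := dualAlgebraStar.rightOp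
            unitIso := η
            counitIso := ε
            functor_unitIso_comp := triangle } ∧
      (∀ (A : DCA.{u}) (a : A),
        let gA : A ⟶ A.dual.dual := (η.inv.app (op A)).unop
        A.dual.region (gA.hom a) = {Γ : A.TClan | a ∈ Γ.1}) ∧
      (∀ (S : DMSStar.{u}) (x : S.obj),
        let ρS : S.obj ⟶ S.obj.dual.dual := (ε.inv.app S).hom
        (ρS.toFun x : S.obj.dual.TClan).1 = {a : S.obj.M | x ∈ (a : RegularClosed S.obj)}) := by
  exact ⟨dualityUnit, dualityCounit, duality_triangle, _, rfl, fun _ _ => rfl, fun _ _ => rfl⟩
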